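/- Let $S$ be a finite set and, for $x\in\mathbf R^S$ and $Z\subseteq S$, write $\widetilde x(Z)=\sum_{s\in Z}x(s)$. All lower bounds below are in $\mathbf Z\cup\{-\infty\}$ and all upper bounds are in $\mathbf Z\cup\{+\infty\}$. *Definitions.* A family of subsets of $S$ is laminar if it has no two members $X,Y$ for which $X\setminus Y$, $Y\setminus X$ and $X\cap Y$ are all non-empty. A laminar g-polymatroid is a (possibly empty) polyhedron $Q(p,b)=\{x\in\mathbf R^S: p(Z)\le\widetilde x(Z)\le b(Z)\ \text{for all } Z\subseteq S\}$, where $p(\emptyset)=b(\emptyset)=0$ and, for some laminar family $\mathcal L$ of non-empty subsets of $S$, $p(Z)=-\infty$ and $b(Z)=+\infty$ for all non-empty $Z\notin\mathcal L$. An elementary prefix-bounded g-polymatroid on a totally ordered set $\{u_1,\dots,u_t\}$ is $\{x:\varphi(u_k)\le x(u_1)+\dots+x(u_k)\le\gamma(u_k),\ k=1,\dots,t\}$ with bounds $\varphi\le\gamma$; a prefix-bounded g-polymatroid is a direct sum of elementary ones. A box is $T(f,g)=\{x: f\le x\le g\}$ with bounds $f\le g$ on $S$, and a plank is $K(\alpha,\beta)=\{x:\alpha\le\widetilde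 x(S)\le\beta\}$ with bounds $\alpha\le\beta$. The $k$-elongation of a polyhedron $\{x:Ax\le b\}$ is $\{x: Ax\le kb\}$. A polyhedron is integral if it is the convex hull of its integral vectors. A vector $z$ is sign-consistent with $w$ if, for each coordinate $j$, $w(j)\ge0$ implies $z(j)\ge0$ and $w(j)\le0$ implies $z(j)\le0$. A polyhedron $Q$ has the *sign-consistent integer Carathéodory property* if for every positive integer $k$ and every integral vector $w$ in the $k$-elongation of $Q$ there are affinely independent integral vectors $z_1,\dots,z_t\in Q$, sign-consistent with $w$, and positive integers $\mu_1,\dots,\mu_t$ with $\mu_1+\dots+\mu_t=k$ and $w=\mu_1z_1+\dots+\mu_tz_t$. It has the *sign-consistent integer decomposition property* if $Q$ is integral and, for every positive integer $k$, every integral vector $w$ in the $k$-elongation of $Q$ is the sum of $k$ integral vectors of $Q$ that are sign-consistent with $w$. Given bounds $\Phi^1\le\Gamma^1$, $\Phi^2\le\Gamma^2$ and $f\le g$ on $[m]\times[n]$ and $\alpha\le\beta$, a prefix-bounded matrix (PBM) defined by $(\Phi^1,\Gamma^1,\Phi^2,\Gamma^2)$ is an integer $m\times n$ matrix $A$ with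 $\Phi^1(i,j)\le\sum_{l\le j}A(i,l)\le\Gamma^1(i,j)$ and $\Phi^2(i,j)\le\sum_{h\le i}A(h,j)\le\Gamma^2(i,j)$ for all $(i,j)$; it is entry-bounded if $f\le A\le g$, and total-sum bounded if $\alpha\le\sum_{i,j}A(i,j)\le\beta$. **Statement.** 1. The intersection of two laminar g-polymatroids (in particular, of two prefix-bounded g-polymatroids) on $S$ with a box and a plank has the sign-consistent integer Carathéodory property and the sign-consistent integer decomposition property. 2. The convex hull of the entry-bounded and total-sum bounded prefix-bounded matrices (for given bounds) has the sign-consistent integer Carathéodory property and the sign-consistent integer decomposition property. 3. Let $A$ be a PBM defined by $(\Phi^1,\Gamma^1,\Phi^2,\Gamma^2)$ whose entries lie between $f$ and $g$ and whose total sum lies between $\alpha$ and $\beta$. Then for every positive integer $k$ there are PBMs $A_1,\dots,A_k$ defined by $\lfloor\Phi^1/k\rfloor,\lceil\Gamma^1/k\rceil,\lfloor\Phi^2/k\rfloor,\lceil\Gamma^2/k\rceil$, with entries between $\lfloor f/k\rfloor$ and $\lceil g/k\rceil$ and total sum between $\lfloor\alpha/k\rfloor$ and $\lceil\beta/k\rceil$,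 such that $A=A_1+\dots+A_k$ and each $A_i$ is sign-consistent with $A$. (Infinite bounds stay infinite.) -/

import Mathlib

open scoped Matrix

/-! ## Integer bounds that may be infinite

Lower bounds are elements of `WithBot ℤ` (an integer or `-∞`), upper bounds are elements of
`WithTop ℤ` (an integer or `+∞`). -/

/-- The (possibly `-∞`) integer lower bound `l` is at most the real number `r`. -/
def LowerLE (l : WithBot ℤ) (r : ℝ) : Prop :=
  WithBot.map (fun a : ℤ => (a : ℝ)) l ≤ (r : WithBot ℝ)

/-- The real number `r` is at most the (possibly `+∞`) integer upper bound `u`. -/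
def LEUpper (r : ℝ) (u : WithTop ℤ) : Prop :=
  (r : WithTop ℝ) ≤ WithTop.map (fun a : ℤ => (a : ℝ)) u

/-- The lower bound `l` is at most the upper bound `u`, as elements of `ℤ ∪ {-∞, +∞}`. -/
def BoundLE (l : WithBot ℤ) (u : WithTop ℤ) : Prop :=
  WithBot.map (fun a : ℤ => (a : WithTop ℤ)) l ≤ (u : WithBot (WithTop ℤ))

/-- `⌊l / k⌋`, with `⌊-∞ / k⌋ = -∞`. -/
def floorDiv (k : ℕ) (l : WithBot ℤ) : WithBot ℤ :=
  l.map fun a : ℤ => ⌊(a : ℚ) / (k : ℚ)⌋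

/-- `⌈u / k⌉`, with `⌈+∞ / k⌉ = +∞`. -/
def ceilDiv (k : ℕ) (u : WithTop ℤ) : WithTop ℤ :=
  u.map fun a : ℤ => ⌈(a : ℚ) / (k : ℚ)⌉

/-! ## Polyhedra, elongations and integer decompositions in `ℝ^S` -/

/-- The real vector with the same entries as an integer vector. -/
def toReal {S : Type*} (z : S → ℤ) : S → ℝ := fun s => (z s : ℝ)

/-- A polyhedron: the solution set of a finite system `A x ≤ b` of linear inequalities. -/
def IsPolyhedron {S : Type*} [Fintype S] (Q : Set (S → ℝ)) : Prop :=
  ∃ (r : ℕ) (A : Matrix (Fin r) S ℝ) (b : Fin r → ℝ), Q = {x | A *ᵥ x ≤ b}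

/-- An integral polyhedron: a polyhedron that is the convex hull of its integral vectors. -/
def IsIntegralPolyhedron {S : Type*} [Fintype S] (Q : Set (S → ℝ)) : Prop :=
  IsPolyhedron Q ∧ Q = convexHull ℝ {x | x ∈ Q ∧ ∃ z : S → ℤ, x = toReal z}

/-- The `k`-elongation `{x | A x ≤ k b}` of a polyhedron `{x | A x ≤ b}`, for a positive
integer `k`. It is the set of all `k y` with `y` in the polyhedron, see `elongation_polyhedron`;
so it does not depend on the system that describes the polyhedron. -/
def elongation {S : Type*} (k : ℕ) (Q : Set (S → ℝ)) : Set (S → ℝ) :=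
  {x | ∃ y ∈ Q, x = (k : ℝ) • y}

theorem elongation_polyhedron {S R : Type*} [Fintype S] (A : Matrix R S ℝ) (b : R → ℝ)
    (k : ℕ) (hk : 0 < k) :
    elongation k {x | A *ᵥ x ≤ b} = {x | A *ᵥ x ≤ (k : ℝ) • b} := by
  have hk' : (0 : ℝ) < k := by exact_mod_cast hk
  ext x
  constructor
  · rintro ⟨y, hy, rfl⟩ i
    have := hy i
    simp only [Matrix.mulVec_smul, Pi.smul_apply, smul_eq_mul]
    exact mul_le_mul_of_nonneg_left this hk'.le
  · intro hx
    refine ⟨(k : ℝ)⁻¹ • x, fun i => ?_, ?_⟩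
    · have := hx i
      simp only [Matrix.mulVec_smul, Pi.smul_apply, smul_eq_mul] at this ⊢
      rw [inv_mul_le_iff₀ hk']
      exact this
    · rw [smul_smul, mul_inv_cancel₀ hk'.ne', one_smul]

/-- The vector `z` is sign-consistent with `w`. -/
def SignConsistent {S : Type*} (z w : S → ℤ) : Prop :=
  ∀ s, (0 ≤ w s → 0 ≤ z s) ∧ (w s ≤ 0 → z s ≤ 0)

/-- The sign-consistent integer Carathéodory property: for every positive integer `k`, every
integral vector `w` of the `k`-elongation of `Q` is `μ₁ z₁ + ⋯ + μₜ zₜ` for affinely independent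
integral vectors `zᵢ ∈ Q` that are sign-consistent with `w` and positive integers `μᵢ` with sum
`k`. -/
def SignConsistentIntegerCaratheodory {S : Type*} (Q : Set (S → ℝ)) : Prop :=
  ∀ k : ℕ, 0 < k → ∀ w : S → ℤ, toReal w ∈ elongation k Q →
    ∃ (t : ℕ) (z : Fin t → S → ℤ) (μ : Fin t → ℕ),
      AffineIndependent ℝ (fun i => toReal (z i)) ∧
      (∀ i, toReal (z i) ∈ Q) ∧
      (∀ i, SignConsistent (z i) w) ∧
      (∀ i, 0 < μ i) ∧
      ∑ i, μ i = k ∧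
      w = ∑ i, μ i • z i

/-- The sign-consistent integer decomposition property of an integral polyhedron `Q`: for every
positive integer `k`, every integral vector of the `k`-elongation of `Q` is the sum of `k`
integral vectors of `Q` that are sign-consistent with it. -/
def SignConsistentIntegerDecomposition {S : Type*} [Fintype S] (Q : Set (S → ℝ)) : Prop :=
  IsIntegralPolyhedron Q ∧
  ∀ k : ℕ, 0 < k → ∀ w : S → ℤ, toReal w ∈ elongation k Q →
    ∃ z : Fin k → S → ℤ,
      (∀ i, toReal (z i) ∈ Q) ∧ (∀ i, SignConsistent (z i) w) ∧ w = ∑ i, z i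

/-! ## Laminar and prefix-bounded g-polymatroids, boxes and planks -/

/-- The polyhedron `Q(p, b) = {x | p(Z) ≤ x(Z) ≤ b(Z) for every Z ⊆ S}`, where `x(Z)` is the sum
of the entries of `x` over `Z`. -/
def borderedPolyhedron {S : Type*} (p : Finset S → WithBot ℤ) (b : Finset S → WithTop ℤ) :
    Set (S → ℝ) :=
  {x | ∀ Z : Finset S, LowerLE (p Z) (∑ s ∈ Z, x s) ∧ LEUpper (∑ s ∈ Z, x s) (b Z)}

def ProperlyIntersecting {S : Type*} [DecidableEq S] (X Y : Finset S) : Prop :=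
  (X \ Y).Nonempty ∧ (Y \ X).Nonempty ∧ (X ∩ Y).Nonempty

/-- A family of subsets is laminar if it contains no two properly intersecting members. -/
def IsLaminar {S : Type*} [DecidableEq S] (L : Set (Finset S)) : Prop :=
  ∀ X ∈ L, ∀ Y ∈ L, ¬ ProperlyIntersecting X Y

/-- A laminar g-polymatroid: `Q(p, b)` for integer-valued set-functions `p` and `b`, zero on the
empty set, which on nonempty sets are finite only on the members of a laminar family of nonempty
sets. Weak paramodularity of `(p, b)` is no further condition: it only concerns properly
intersecting `X`, `Y`, and then `X` or `Y` is outside the family, so that the inequalities hold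
with an infinite side. `Q(p, b)` may be empty. -/
def IsLaminarGPolymatroid {S : Type*} [DecidableEq S] (Q : Set (S → ℝ)) : Prop :=
  ∃ (L : Set (Finset S)) (p : Finset S → WithBot ℤ) (b : Finset S → WithTop ℤ),
    IsLaminar L ∧ (∀ Z ∈ L, Z.Nonempty) ∧
    p ∅ = 0 ∧ b ∅ = 0 ∧
    (∀ Z : Finset S, Z.Nonempty → Z ∉ L → p Z = ⊥ ∧ b Z = ⊤) ∧
    Q = borderedPolyhedron p b

/-- The elementary prefix-bounded g-polymatroid on the totally ordered set `Fin t`: bounds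
`φ k ≤ x₀ + ⋯ + xₖ ≤ γ k` on the sums over all (nonempty) prefixes. -/
def elementaryPrefixBounded {t : ℕ} (φ : Fin t → WithBot ℤ) (γ : Fin t → WithTop ℤ) :
    Set (Fin t → ℝ) :=
  {x | ∀ k, LowerLE (φ k) (∑ l ∈ Finset.Iic k, x l) ∧ LEUpper (∑ l ∈ Finset.Iic k, x l) (γ k)}

/-- A prefix-bounded g-polymatroid: a direct sum of elementary ones. The bijection `e` splits
the ground-set into totally ordered blocks. -/
def IsPrefixBoundedGPolymatroid {S : Type*} (Q : Set (S → ℝ)) : Prop :=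
  ∃ (q : ℕ) (t : Fin q → ℕ) (e : (Σ i : Fin q, Fin (t i)) ≃ S)
    (φ : ∀ i, Fin (t i) → WithBot ℤ) (γ : ∀ i, Fin (t i) → WithTop ℤ),
    (∀ i k, BoundLE (φ i k) (γ i k)) ∧
    Q = {x | ∀ i, (fun k => x (e ⟨i, k⟩)) ∈ elementaryPrefixBounded (φ i) (γ i)}

/-- The box `T(f, g) = {x | f ≤ x ≤ g}`. -/
def box {S : Type*} (f : S → WithBot ℤ) (g : S → WithTop ℤ) : Set (S → ℝ) :=
  {x | ∀ s, LowerLE (f s) (x s) ∧ LEUpper (x s) (g s)}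

/-- The plank `K(α, β) = {x | α ≤ x(S) ≤ β}`. -/
def plank (S : Type*) [Fintype S] (α : WithBot ℤ) (β : WithTop ℤ) : Set (S → ℝ) :=
  {x | LowerLE α (∑ s, x s) ∧ LEUpper (∑ s, x s) β}

/-! ## Prefix-bounded matrices

An `m × n` matrix is a function on the set `Fin m × Fin n` of positions. -/

/-- Bounds on an `m × n` prefix-bounded matrix: `Φ₁, Γ₁` on the sums of the horizontal prefixes,
`Φ₂, Γ₂` on the sums of the vertical prefixes, `f, g` on the entries, `α, β` on the total sum. -/
structure PBMBounds (m n : ℕ) where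
  Φ₁ : Fin m × Fin n → WithBot ℤ
  Γ₁ : Fin m × Fin n → WithTop ℤ
  Φ₂ : Fin m × Fin n → WithBot ℤ
  Γ₂ : Fin m × Fin n → WithTop ℤ
  f : Fin m × Fin n → WithBot ℤ
  g : Fin m × Fin n → WithTop ℤ
  α : WithBot ℤ
  β : WithTop ℤ

/-- Each lower bound is at most the corresponding upper bound. -/
structure PBMBounds.Consistent {m n : ℕ} (B : PBMBounds m n) : Prop where
  horizontal : ∀ s, BoundLE (B.Φ₁ s) (B.Γ₁ s)
  vertical : ∀ s, BoundLE (B.Φ₂ s) (B.Γ₂ s)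
  entry : ∀ s, BoundLE (B.f s) (B.g s)
  total : BoundLE B.α B.β

/-- All lower bounds divided by `k` and rounded down, all upper bounds divided by `k` and rounded
up. -/
def PBMBounds.div {m n : ℕ} (B : PBMBounds m n) (k : ℕ) : PBMBounds m n where
  Φ₁ s := floorDiv k (B.Φ₁ s)
  Γ₁ s := ceilDiv k (B.Γ₁ s)
  Φ₂ s := floorDiv k (B.Φ₂ s)
  Γ₂ s := ceilDiv k (B.Γ₂ s)
  f s := floorDiv k (B.f s)
  g s := ceilDiv k (B.g s)
  α := floorDiv k B.α
  β := ceilDiv k B.β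

/-- The integer matrix `A` is an entry-bounded and total-sum bounded prefix-bounded matrix for
the bounds `B`. -/
structure IsPBM {m n : ℕ} (B : PBMBounds m n) (A : Fin m × Fin n → ℤ) : Prop where
  horizontal : ∀ i j, B.Φ₁ (i, j) ≤ ((∑ l ∈ Finset.Iic j, A (i, l) : ℤ) : WithBot ℤ) ∧
    ((∑ l ∈ Finset.Iic j, A (i, l) : ℤ) : WithTop ℤ) ≤ B.Γ₁ (i, j)
  vertical : ∀ i j, B.Φ₂ (i, j) ≤ ((∑ h ∈ Finset.Iic i, A (h, j) : ℤ) : WithBot ℤ) ∧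
    ((∑ h ∈ Finset.Iic i, A (h, j) : ℤ) : WithTop ℤ) ≤ B.Γ₂ (i, j)
  entry : ∀ s, B.f s ≤ ((A s : ℤ) : WithBot ℤ) ∧ ((A s : ℤ) : WithTop ℤ) ≤ B.g s
  total : B.α ≤ ((∑ s, A s : ℤ) : WithBot ℤ) ∧ ((∑ s, A s : ℤ) : WithTop ℤ) ≤ B.β

/-- The convex hull of the entry-bounded and total-sum bounded prefix-bounded matrices. -/
def pbmHull {m n : ℕ} (B : PBMBounds m n) : Set (Fin m × Fin n → ℝ) :=
  convexHull ℝ {x | ∃ A : Fin m × Fin n → ℤ, IsPBM B A ∧ x = toReal A}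

/-! Let `w` be an integral vector in the `k`-elongation of `Q`, so that `k⁻¹ w` lies in `Q`. Adding
all singletons and the ground-set to the first laminar family keeps it laminar and absorbs the box
and the plank. Let `P` be the polytope of all vectors whose sum over each member of the two families
lies between the floor and the ceiling of the corresponding sum of `k⁻¹ w`. As the bounds of `Q` are
integers, `P` is contained in `Q`. As singletons are members, integral points of `P` are
sign-consistent with `w`. So it suffices to decompose `w` over integral points of `P`.

Every non-empty face of `P` has an integral point (`exists_laminar_rounding`). If a vector has
fractional coordinates, consider the members with integral sums. Differences of these sums partition
the labelled elements into classes with integral sums, and a class that meets the fractional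
elements contains at least two of them. The two families thus give at most as many equations as
there are fractional coordinates, and in the case of equality one equation is redundant
(`exists_direction`). Hence the vector can be moved along its fractional coordinates with all
integral sums fixed, until a further member sum becomes integral.

`P` is compressed: each slack is 0 or 1 at an integral point. Pulling gives the decomposition
(`exists_pulling_decomposition`). Take an integral point `x` of the current face and subtract the
largest multiple `l x` that leaves `w - l x` in `(k - l) P`. A new constraint becomes tight, and the
process continues in a smaller face, on which that constraint is constant while `x` violates
equality; this gives affine independence. Since the slack of `x` is 1, `l` is itself a slack of `w`,
hence an integer. With `k = 1` and real coefficients the same argument shows that `Q` is integral.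

A single matrix `A` decomposes because `k⁻¹ A` obeys the divided and rounded bounds. -/

/-- The integers as an additive subgroup of the reals. -/
def intSubgroup : AddSubgroup ℝ := (Int.castAddHom ℝ).range

theorem mem_intSubgroup {r : ℝ} : r ∈ intSubgroup ↔ ∃ n : ℤ, (n : ℝ) = r :=
  Iff.rfl

theorem intCast_mem_intSubgroup (n : ℤ) : (n : ℝ) ∈ intSubgroup := mem_intSubgroup.2 ⟨n, rfl⟩

/-- Any two members of the family are nested or disjoint. -/
def NestedOrDisjoint {S : Type*} (L : Set (Finset S)) : Prop :=
  ∀ X ∈ L, ∀ Y ∈ L, X ⊆ Y ∨ Y ⊆ X ∨ Disjoint X Y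

theorem IsLaminar.nestedOrDisjoint {S : Type*} [DecidableEq S] {L : Set (Finset S)}
    (h : IsLaminar L) : NestedOrDisjoint L := by
  intro X hX Y hY
  have := h X hX Y hY
  simp only [ProperlyIntersecting, not_and_or, Finset.not_nonempty_iff_eq_empty,
    Finset.sdiff_eq_empty_iff_subset, ← Finset.disjoint_iff_inter_eq_empty] at this
  exact this

/-! ### Directions that preserve the sums over the classes of two labellings -/

/-- More coordinates than homogeneous equations leave a nonzero solution. -/
theorem exists_ne_zero_of_card_lt {S ι : Type*} [Fintype S] [Fintype ι] (E : Finset S)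
    (C : ι → Finset S) (h : Fintype.card ι < E.card) :
    ∃ v : S → ℝ, v ≠ 0 ∧ (∀ s ∉ E, v s = 0) ∧ ∀ i, ∑ s ∈ C i, v s = 0 := by
  classical
  -- Vanishing outside `E` is imposed by further equations, one for each coordinate; the total
  -- number of equations is still below the dimension.
  let F : (S → ℝ) →ₗ[ℝ] ((ι ⊕ {s // s ∉ E}) → ℝ) :=
    LinearMap.pi fun j => Sum.elim (fun i => ∑ s ∈ C i, LinearMap.proj s)
      (fun s => LinearMap.proj s.1) j
  have hlt : Module.finrank ℝ ((ι ⊕ {s // s ∉ E}) → ℝ) < Module.finrank ℝ (S → ℝ) := by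
    have h1 : Fintype.card {s // s ∉ E} = Fintype.card S - E.card := by
      rw [Fintype.card_subtype_compl, Fintype.card_coe]
    have h2 := E.card_le_univ
    simp only [Module.finrank_fintype_fun_eq_card, Fintype.card_sum, h1]
    omega
  obtain ⟨v, hv, hv0⟩ := (Submodule.ne_bot_iff _).1 (LinearMap.ker_ne_bot_of_finrank_lt hlt (f := F))
  rw [LinearMap.mem_ker] at hv
  refine ⟨v, hv0, fun s hs => ?_, fun i => ?_⟩
  · simpa [F] using congrFun hv (Sum.inr ⟨s, hs⟩)
  · simpa [F] using congrFun hv (Sum.inl i)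

section Fibres

variable {S α : Type*} [DecidableEq α]

/-- The labels of the elements of `E`. -/
def labels (m : S → Option α) (E : Finset S) : Finset α := (E.image m).eraseNone

theorem mem_labels {m : S → Option α} {E : Finset S} {a : α} :
    a ∈ labels m E ↔ ∃ s ∈ E, m s = some a := by
  simp [labels]

theorem sum_card_fibre_labels (m : S → Option α) (E : Finset S) :
    ∑ a ∈ labels m E, (E.filter fun s => m s = some a).card =
      (E.filter fun s => m s ≠ none).card := by
  classical
  rw [← Finset.card_biUnion]
  · congr 1
    ext s
    simp only [Finset.mem_biUnion, Finset.mem_filter, mem_labels, Option.ne_none_iff_exists']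
    constructor
    · rintro ⟨a, -, hs, ha⟩
      exact ⟨hs, a, ha⟩
    · rintro ⟨hs, a, ha⟩
      exact ⟨a, ⟨s, hs, ha⟩, hs, ha⟩
  · intro a _ b _ hab
    rw [Function.onFun, Finset.disjoint_left]
    intro s h1 h2
    rw [Finset.mem_filter] at h1 h2
    exact hab (Option.some_injective _ (h1.2.symm.trans h2.2))

variable [Fintype S]

/-- The elements labelled `a`. -/
def fibre (m : S → Option α) (a : α) : Finset S := Finset.univ.filter fun s => m s = some a

theorem mem_fibre {m : S → Option α} {a : α} {s : S} : s ∈ fibre m a ↔ m s = some a := by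
  simp [fibre]

/-- If all fibre sums are integral, every label of a fractional element occurs twice among the
fractional elements. -/
theorem one_lt_card_fractional_fibre {m : S → Option α} {x : S → ℝ} {E : Finset S}
    (hE : ∀ s, s ∈ E ↔ x s ∉ intSubgroup) (hm : ∀ a, ∑ s ∈ fibre m a, x s ∈ intSubgroup)
    {a : α} (ha : a ∈ labels m E) : 2 ≤ (E.filter fun s => m s = some a).card := by
  classical
  obtain ⟨s, hs, hsa⟩ := mem_labels.1 ha
  have hpos : 0 < (E.filter fun s => m s = some a).card :=
    Finset.card_pos.2 ⟨s, Finset.mem_filter.2 ⟨hs, hsa⟩⟩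
  by_contra hlt
  obtain ⟨s', hs'⟩ := Finset.card_eq_one.1 (show (E.filter fun s => m s = some a).card = 1 by omega)
  have hss : s = s' := by
    have : s ∈ E.filter fun s => m s = some a := Finset.mem_filter.2 ⟨hs, hsa⟩
    rwa [hs', Finset.mem_singleton] at this
  subst hss
  refine (hE s).1 hs ?_
  -- If `s` is the only fractional element of its class, then `x s` is the class sum minus integers.
  have hsum := Finset.add_sum_erase (fibre m a) x (mem_fibre.2 hsa)
  have hrest : ∑ t ∈ (fibre m a).erase s, x t ∈ intSubgroup := by
    refine sum_mem fun t ht => ?_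
    by_contra hx
    have : t ∈ E.filter fun s => m s = some a :=
      Finset.mem_filter.2 ⟨(hE t).2 hx, mem_fibre.1 (Finset.mem_of_mem_erase ht)⟩
    rw [hs', Finset.mem_singleton] at this
    exact Finset.ne_of_mem_erase ht this
  have := sub_mem (hm a) hrest
  rwa [← hsum, add_sub_cancel_right] at this

/-- The factor two lets two labellings together produce at most `E.card` equations. -/
theorem two_mul_card_labels_le {m : S → Option α} {x : S → ℝ} {E : Finset S}
    (hE : ∀ s, s ∈ E ↔ x s ∉ intSubgroup) (hm : ∀ a, ∑ s ∈ fibre m a, x s ∈ intSubgroup) :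
    2 * (labels m E).card ≤ (E.filter fun s => m s ≠ none).card := by
  rw [← sum_card_fibre_labels, mul_comm, ← smul_eq_mul]
  exact Finset.card_nsmul_le_sum _ _ _ fun a ha => one_lt_card_fractional_fibre hE hm ha

theorem sum_fibre_labels {m : S → Option α} {E : Finset S} {v : S → ℝ}
    (hv : ∀ s ∉ E, v s = 0) (hm : ∀ s ∈ E, m s ≠ none) :
    ∑ a ∈ labels m E, ∑ s ∈ fibre m a, v s = ∑ s, v s := by
  classical
  have h1 : ∀ a, ∑ s ∈ fibre m a, v s = ∑ s ∈ E.filter (fun s => m s = some a), v s := by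
    intro a
    symm
    refine Finset.sum_subset (fun s hs => mem_fibre.2 (Finset.mem_filter.1 hs).2) ?_
    intro s hs hs'
    refine hv s fun hsE => hs' (Finset.mem_filter.2 ⟨hsE, mem_fibre.1 hs⟩)
  simp_rw [h1]
  rw [← Finset.sum_biUnion]
  · refine Finset.sum_subset (Finset.subset_univ _) fun s _ hs => hv s fun hsE => hs ?_
    obtain ⟨a, ha⟩ := Option.ne_none_iff_exists'.1 (hm s hsE)
    exact Finset.mem_biUnion.2 ⟨a, mem_labels.2 ⟨s, hsE, ha⟩, Finset.mem_filter.2 ⟨hsE, ha⟩⟩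
  · intro a _ b _ hab
    rw [Function.onFun, Finset.disjoint_left]
    intro s h1 h2
    rw [Finset.mem_filter] at h1 h2
    exact hab (Option.some_injective _ (h1.2.symm.trans h2.2))

theorem sum_fibre_eq_zero_of_notMem_labels {m : S → Option α} {E : Finset S} {v : S → ℝ}
    (hv : ∀ s ∉ E, v s = 0) {a : α} (ha : a ∉ labels m E) : ∑ s ∈ fibre m a, v s = 0 :=
  Finset.sum_eq_zero fun s hs => hv s fun hsE => ha (mem_labels.2 ⟨s, hsE, mem_fibre.1 hs⟩)

/-- A vector with a fractional coordinate whose fibre sums are integral for two labellings can be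
moved along its fractional coordinates without changing these sums. -/
theorem exists_direction {β : Type*} [DecidableEq β] (m₁ : S → Option α) (m₂ : S → Option β)
    (x : S → ℝ) (h₁ : ∀ a, ∑ s ∈ fibre m₁ a, x s ∈ intSubgroup)
    (h₂ : ∀ b, ∑ s ∈ fibre m₂ b, x s ∈ intSubgroup) (hx : ∃ s, x s ∉ intSubgroup) :
    ∃ v : S → ℝ, v ≠ 0 ∧ (∀ s, x s ∈ intSubgroup → v s = 0) ∧
      (∀ a, ∑ s ∈ fibre m₁ a, v s = 0) ∧ ∀ b, ∑ s ∈ fibre m₂ b, v s = 0 := by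
  classical
  set E : Finset S := Finset.univ.filter fun s => x s ∉ intSubgroup with hEdef
  have hE : ∀ s, s ∈ E ↔ x s ∉ intSubgroup := by simp [hEdef]
  have hsupp : ∀ v : S → ℝ, (∀ s ∉ E, v s = 0) → ∀ s, x s ∈ intSubgroup → v s = 0 :=
    fun v hv s hs => hv s fun h => (hE s).1 h hs
  have c₁ := two_mul_card_labels_le hE h₁
  have c₂ := two_mul_card_labels_le hE h₂
  have d₁ := Finset.card_filter_le E fun s => m₁ s ≠ none
  have d₂ := Finset.card_filter_le E fun s => m₂ s ≠ none
  obtain ⟨s₀, hs₀⟩ := hx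
  have hEpos : 0 < E.card := Finset.card_pos.2 ⟨s₀, (hE s₀).2 hs₀⟩
  -- Each labelling uses at most half of `E.card` labels, so the count can fail only with equality
  -- throughout.
  by_cases hlt : (labels m₁ E).card + (labels m₂ E).card < E.card
  · obtain ⟨v, hv0, hvE, hv⟩ := exists_ne_zero_of_card_lt E
      (Sum.elim (fun a : labels m₁ E => fibre m₁ a.1) (fun b : labels m₂ E => fibre m₂ b.1))
      (by simpa using hlt)
    refine ⟨v, hv0, hsupp v hvE, fun a => ?_, fun b => ?_⟩
    · by_cases ha : a ∈ labels m₁ E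
      · exact hv (Sum.inl ⟨a, ha⟩)
      · exact sum_fibre_eq_zero_of_notMem_labels hvE ha
    · by_cases hb : b ∈ labels m₂ E
      · exact hv (Sum.inr ⟨b, hb⟩)
      · exact sum_fibre_eq_zero_of_notMem_labels hvE hb
  -- In the case of equality both labellings are defined on all of `E`. Both systems of equations
  -- then add up to the same total, so the equation of one label `a₀` can be dropped.
  · have n₁ : ∀ s ∈ E, m₁ s ≠ none :=
      Finset.filter_eq_self.1 (Finset.eq_of_subset_of_card_le (Finset.filter_subset _ _) (by omega))
    have n₂ : ∀ s ∈ E, m₂ s ≠ none :=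
      Finset.filter_eq_self.1 (Finset.eq_of_subset_of_card_le (Finset.filter_subset _ _) (by omega))
    obtain ⟨a₀, ha₀⟩ := Finset.card_pos.1 (show 0 < (labels m₁ E).card by omega)
    have herase := Finset.card_erase_of_mem ha₀
    obtain ⟨v, hv0, hvE, hv⟩ := exists_ne_zero_of_card_lt E
      (Sum.elim (fun a : (labels m₁ E).erase a₀ => fibre m₁ a.1)
        (fun b : labels m₂ E => fibre m₂ b.1))
      (by simp only [Fintype.card_sum, Fintype.card_coe]; omega)
    have hb : ∀ b, ∑ s ∈ fibre m₂ b, v s = 0 := by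
      intro b
      by_cases hb : b ∈ labels m₂ E
      · exact hv (Sum.inr ⟨b, hb⟩)
      · exact sum_fibre_eq_zero_of_notMem_labels hvE hb
    refine ⟨v, hv0, hsupp v hvE, fun a => ?_, hb⟩
    by_cases ha : a ∈ labels m₁ E
    · by_cases haa : a = a₀
      · subst haa
        -- The total of `v` is zero by the second labelling; the first labelling splits it into
        -- class sums, all zero except possibly the one dropped.
        have e₁ := sum_fibre_labels hvE n₁
        rw [← sum_fibre_labels hvE n₂, Finset.sum_eq_zero fun b _ => hb b,
          ← Finset.add_sum_erase _ _ ha, Finset.sum_eq_zero (s := (labels m₁ E).erase a)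
            fun c hc => hv (Sum.inl ⟨c, hc⟩), add_zero] at e₁
        exact e₁
      · exact hv (Sum.inl ⟨a, Finset.mem_erase.2 ⟨haa, ha⟩⟩)
    · exact sum_fibre_eq_zero_of_notMem_labels hvE ha

end Fibres

/-! ### Laminar families turned into partitions -/

/-- Each element is labelled with the smallest member containing it, of those members of a laminar
family on which `x` has an integral sum. -/
theorem exists_minimal_labelling {S : Type*} [Fintype S] {L : Set (Finset S)}
    (hL : NestedOrDisjoint L) :
    ∃ m : S → Option (Finset S), (∀ s Y, m s = some Y → Y ∈ L ∧ s ∈ Y) ∧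
      ∀ Z ∈ L, ∀ s ∈ Z, ∃ Y ⊆ Z, m s = some Y := by
  classical
  have key : ∀ s, ∃ o : Option (Finset S), (∀ Y, o = some Y → Y ∈ L ∧ s ∈ Y) ∧
      ∀ Z ∈ L, s ∈ Z → ∃ Y ⊆ Z, o = some Y := by
    intro s
    set T : Finset (Finset S) := Finset.univ.filter fun Z => Z ∈ L ∧ s ∈ Z with hT
    have hTm : ∀ Z, Z ∈ T ↔ Z ∈ L ∧ s ∈ Z := by simp [hT]
    by_cases hne : T.Nonempty
    · obtain ⟨Y, hY, hmin⟩ := Finset.exists_min_image T Finset.card hne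
      have hY' := (hTm Y).1 hY
      refine ⟨some Y, ?_, fun Z hZ hs => ⟨Y, ?_, rfl⟩⟩
      · rintro _ ⟨⟩
        exact hY'
      · rcases hL Y hY'.1 Z hZ with h | h | h
        · exact h
        · exact (Finset.eq_of_subset_of_card_le h (hmin Z ((hTm Z).2 ⟨hZ, hs⟩))).ge
        · exact absurd hs (Finset.disjoint_left.1 h hY'.2)
    · refine ⟨none, by simp, fun Z hZ hs => absurd ⟨Z, (hTm Z).2 ⟨hZ, hs⟩⟩ hne⟩
  choose m h1 h2 using key
  exact ⟨m, h1, fun Z hZ s hs => h2 s Z hZ hs⟩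

/-- An element of `Z` has its label inside `Z`, and a class lies inside its label; so the classes of
the labels occurring in `Z` partition `Z`. -/
theorem sum_eq_sum_labels {S : Type*} [Fintype S] [DecidableEq S] {L : Set (Finset S)}
    {m : S → Option (Finset S)} (h1 : ∀ s Y, m s = some Y → Y ∈ L ∧ s ∈ Y)
    (h2 : ∀ Z ∈ L, ∀ s ∈ Z, ∃ Y ⊆ Z, m s = some Y) {Z : Finset S} (hZ : Z ∈ L) (u : S → ℝ) :
    ∑ s ∈ Z, u s = ∑ Y ∈ labels m Z, ∑ s ∈ fibre m Y, u s := by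
  rw [← Finset.sum_biUnion]
  · congr 1
    ext s
    simp only [Finset.mem_biUnion, mem_labels, mem_fibre]
    constructor
    · intro hs
      obtain ⟨Y, -, hY⟩ := h2 Z hZ s hs
      exact ⟨Y, ⟨s, hs, hY⟩, hY⟩
    · rintro ⟨Y, ⟨s', hs', hY'⟩, hY⟩
      obtain ⟨Y'', hsub, hY''⟩ := h2 Z hZ s' hs'
      obtain rfl : Y'' = Y := Option.some_injective _ (hY''.symm.trans hY')
      exact hsub (h1 s _ hY).2
  · intro a _ b _ hab
    rw [Function.onFun, Finset.disjoint_left]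
    intro s h1 h2
    rw [mem_fibre] at h1 h2
    exact hab (Option.some_injective _ (h1.symm.trans h2))

/-- Induction on inclusion: the class of `Z` is `Z` minus the classes of strictly smaller labels,
whose sums are already integral. A set that labels nothing has an empty class. -/
theorem sum_fibre_mem_intSubgroup {S : Type*} [Fintype S] [DecidableEq S] {L : Set (Finset S)}
    {m : S → Option (Finset S)} (h1 : ∀ s Y, m s = some Y → Y ∈ L ∧ s ∈ Y)
    (h2 : ∀ Z ∈ L, ∀ s ∈ Z, ∃ Y ⊆ Z, m s = some Y) {x : S → ℝ}
    (hx : ∀ Z ∈ L, ∑ s ∈ Z, x s ∈ intSubgroup) (Z : Finset S) :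
    ∑ s ∈ fibre m Z, x s ∈ intSubgroup := by
  induction Z using Finset.strongInduction with
  | H Z ih =>
    by_cases hne : (fibre m Z).Nonempty
    · obtain ⟨s, hs⟩ := hne
      rw [mem_fibre] at hs
      obtain ⟨hZ, hsZ⟩ := h1 s Z hs
      have hsum := sum_eq_sum_labels h1 h2 hZ x
      rw [← Finset.add_sum_erase _ _ (mem_labels.2 ⟨s, hsZ, hs⟩)] at hsum
      have hrest : ∑ Y ∈ (labels m Z).erase Z, ∑ s ∈ fibre m Y, x s ∈ intSubgroup := by
        refine sum_mem fun Y hY => ih Y ?_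
        obtain ⟨hYne, hY⟩ := Finset.mem_erase.1 hY
        obtain ⟨s', hs', hY'⟩ := mem_labels.1 hY
        obtain ⟨Y'', hsub, hY''⟩ := h2 Z hZ s' hs'
        obtain rfl : Y'' = Y := Option.some_injective _ (hY''.symm.trans hY')
        exact Finset.ssubset_iff_subset_ne.2 ⟨hsub, hYne⟩
      have := sub_mem (hx Z hZ) hrest
      rwa [hsum, add_sub_cancel_right] at this
    · rw [Finset.not_nonempty_iff_eq_empty.1 hne, Finset.sum_empty]
      exact zero_mem _

/-- For two laminar families, a fractional vector can be moved without changing its integral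
coordinates and its integral sums over members. -/
theorem exists_laminar_direction {S : Type*} [Fintype S] {L₁ L₂ : Set (Finset S)}
    (h₁ : NestedOrDisjoint L₁) (h₂ : NestedOrDisjoint L₂) {x : S → ℝ}
    (hx : ∃ s, x s ∉ intSubgroup) :
    ∃ v : S → ℝ, v ≠ 0 ∧ (∀ s, x s ∈ intSubgroup → v s = 0) ∧
      ∀ Z ∈ L₁ ∪ L₂, ∑ s ∈ Z, x s ∈ intSubgroup → ∑ s ∈ Z, v s = 0 := by
  classical
  -- Only members with an integral sum impose equations; subfamilies inherit laminarity.
  let T : Set (Finset S) := {Z | ∑ s ∈ Z, x s ∈ intSubgroup}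
  have hT₁ : NestedOrDisjoint (L₁ ∩ T) := fun X hX Y hY => h₁ X hX.1 Y hY.1
  have hT₂ : NestedOrDisjoint (L₂ ∩ T) := fun X hX Y hY => h₂ X hX.1 Y hY.1
  obtain ⟨m₁, a₁, b₁⟩ := exists_minimal_labelling hT₁
  obtain ⟨m₂, a₂, b₂⟩ := exists_minimal_labelling hT₂
  obtain ⟨v, hv0, hvx, hv₁, hv₂⟩ := exists_direction m₁ m₂ x
    (sum_fibre_mem_intSubgroup a₁ b₁ fun Z hZ => hZ.2)
    (sum_fibre_mem_intSubgroup a₂ b₂ fun Z hZ => hZ.2) hx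
  refine ⟨v, hv0, hvx, ?_⟩
  rintro Z (hZ | hZ) hZx
  · rw [sum_eq_sum_labels a₁ b₁ ⟨hZ, hZx⟩]
    exact Finset.sum_eq_zero fun Y _ => hv₁ Y
  · rw [sum_eq_sum_labels a₂ b₂ ⟨hZ, hZx⟩]
    exact Finset.sum_eq_zero fun Y _ => hv₂ Y

/-! ### Simultaneous rounding for two laminar families -/

/-- Two reals `a`, `b` such that `b` lies between `⌊a⌋` and `⌈a⌉`. -/
def Rounds (a b : ℝ) : Prop := (⌊a⌋ : ℝ) ≤ b ∧ b ≤ (⌈a⌉ : ℝ)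

theorem Rounds.refl (a : ℝ) : Rounds a a := ⟨Int.floor_le a, Int.le_ceil a⟩

theorem Rounds.trans {a b c : ℝ} (h : Rounds a b) (h' : Rounds b c) : Rounds a c :=
  ⟨(Int.cast_le.2 (Int.le_floor.2 h.1)).trans h'.1, h'.2.trans (Int.cast_le.2 (Int.ceil_le.2 h.2))⟩

theorem Rounds.eq_of_mem {a b : ℝ} (h : Rounds a b) (ha : a ∈ intSubgroup) : b = a := by
  obtain ⟨n, rfl⟩ := mem_intSubgroup.1 ha
  simp only [Rounds, Int.floor_intCast, Int.ceil_intCast] at h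
  exact le_antisymm h.2 h.1

/-- Moving from `a` at speed `d ≠ 0`, the first integer is reached at a positive time, and all
positions before are between `⌊a⌋` and `⌈a⌉`. -/
theorem exists_first_integer_time {a d : ℝ} (ha : a ∉ intSubgroup) (hd : d ≠ 0) :
    ∃ t : ℝ, 0 < t ∧ a + t * d ∈ intSubgroup ∧ ∀ r, 0 ≤ r → r ≤ t → Rounds a (a + r * d) := by
  have hf : (⌊a⌋ : ℝ) < a :=
    lt_of_le_of_ne (Int.floor_le a) fun h => ha (mem_intSubgroup.2 ⟨_, h⟩)
  have hc : a < (⌈a⌉ : ℝ) :=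
    lt_of_le_of_ne (Int.le_ceil a) fun h => ha (mem_intSubgroup.2 ⟨_, h.symm⟩)
  rcases lt_or_gt_of_ne hd with hd | hd
  · refine ⟨(a - ⌊a⌋) / (-d), div_pos (by linarith) (by linarith), ?_, fun r h0 hr => ?_⟩
    · refine mem_intSubgroup.2 ⟨⌊a⌋, ?_⟩
      field_simp
      ring
    · rw [le_div_iff₀ (by linarith)] at hr
      have := mul_nonneg h0 (neg_pos.2 hd).le
      constructor <;> linarith
  · refine ⟨(⌈a⌉ - a) / d, div_pos (by linarith) hd, ?_, fun r h0 hr => ?_⟩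
    · refine mem_intSubgroup.2 ⟨⌈a⌉, ?_⟩
      field_simp
      ring
    · rw [le_div_iff₀ hd] at hr
      have := mul_nonneg h0 hd.le
      constructor <;> linarith

/-- Simultaneous rounding: if all singletons are members of one of two laminar families, every
real vector can be rounded so that the sums over all members are rounded too. -/
theorem exists_laminar_rounding {S : Type*} [Fintype S] {L₁ L₂ : Set (Finset S)}
    (h₁ : NestedOrDisjoint L₁) (h₂ : NestedOrDisjoint L₂) (hs : ∀ s, {s} ∈ L₁ ∪ L₂) (x : S → ℝ) :
    ∃ y : S → ℤ, ∀ Z ∈ L₁ ∪ L₂, Rounds (∑ s ∈ Z, x s) (∑ s ∈ Z, toReal y s) := by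
  classical
  -- The induction decreases the number of members with a fractional sum.
  let fr : (S → ℝ) → Finset (Finset S) := fun x =>
    Finset.univ.filter fun Z => Z ∈ L₁ ∪ L₂ ∧ ∑ s ∈ Z, x s ∉ intSubgroup
  have hfr : ∀ x Z, Z ∈ fr x ↔ Z ∈ L₁ ∪ L₂ ∧ ∑ s ∈ Z, x s ∉ intSubgroup := by simp [fr]
  induction hn : (fr x).card using Nat.strong_induction_on generalizing x with
  | _ n ih =>
    subst hn
    by_cases hx : ∃ s, x s ∉ intSubgroup
    · obtain ⟨v, hv0, hvx, hv⟩ := exists_laminar_direction h₁ h₂ hx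
      -- Members whose sum is integral or does not move get the unused value 0.
      have hex : ∀ Z : Finset S, ∃ t : ℝ, ∑ s ∈ Z, x s ∉ intSubgroup → ∑ s ∈ Z, v s ≠ 0 →
          0 < t ∧ (∑ s ∈ Z, x s) + t * (∑ s ∈ Z, v s) ∈ intSubgroup ∧ ∀ r, 0 ≤ r → r ≤ t →
            Rounds (∑ s ∈ Z, x s) ((∑ s ∈ Z, x s) + r * (∑ s ∈ Z, v s)) := by
        intro Z
        by_cases h : ∑ s ∈ Z, x s ∉ intSubgroup ∧ ∑ s ∈ Z, v s ≠ 0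
        · obtain ⟨t, ht⟩ := exists_first_integer_time h.1 h.2
          exact ⟨t, fun _ _ => ht⟩
        · exact ⟨0, fun h1 h2 => absurd ⟨h1, h2⟩ h⟩
      choose t ht using hex
      obtain ⟨s₀, hs₀⟩ := Function.ne_iff.1 hv0
      -- `Z₀` is the first member to reach an integral sum. A candidate exists: the singleton of a
      -- coordinate that moves.
      obtain ⟨Z₀, hZ₀, hmin⟩ := Finset.exists_min_image
        ((fr x).filter fun Z => ∑ s ∈ Z, v s ≠ 0) t ⟨{s₀}, by
          rw [Finset.mem_filter, hfr, Finset.sum_singleton, Finset.sum_singleton]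
          exact ⟨⟨hs s₀, fun h => hs₀ (hvx s₀ h)⟩, hs₀⟩⟩
      obtain ⟨hZ₀fr, hZ₀v⟩ := Finset.mem_filter.1 hZ₀
      obtain ⟨hZ₀L, hZ₀x⟩ := (hfr _ _).1 hZ₀fr
      obtain ⟨hpos, hint, -⟩ := ht Z₀ hZ₀x hZ₀v
      have hsum : ∀ Z : Finset S, ∑ s ∈ Z, (x + t Z₀ • v) s =
          (∑ s ∈ Z, x s) + t Z₀ * ∑ s ∈ Z, v s := by
        intro Z
        simp [Finset.sum_add_distrib, Finset.mul_sum]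
      have hround : ∀ Z ∈ L₁ ∪ L₂, Rounds (∑ s ∈ Z, x s) (∑ s ∈ Z, (x + t Z₀ • v) s) := by
        intro Z hZ
        rw [hsum]
        by_cases hvZ : ∑ s ∈ Z, v s = 0
        · rw [hvZ, mul_zero, add_zero]
          exact Rounds.refl _
        · have hxZ : ∑ s ∈ Z, x s ∉ intSubgroup := fun h => hvZ (hv Z hZ h)
          exact (ht Z hxZ hvZ).2.2 _ hpos.le
            (hmin Z (Finset.mem_filter.2 ⟨(hfr _ _).2 ⟨hZ, hxZ⟩, hvZ⟩))
      have hlt : (fr (x + t Z₀ • v)).card < (fr x).card := by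
        refine Finset.card_lt_card (Finset.ssubset_iff_of_subset ?_ |>.2 ⟨Z₀, hZ₀fr, ?_⟩)
        · intro Z hZ
          obtain ⟨hZL, hZx⟩ := (hfr _ _).1 hZ
          refine (hfr _ _).2 ⟨hZL, fun h => hZx ?_⟩
          rw [(hround Z hZL).eq_of_mem h]
          exact h
        · intro h
          refine ((hfr _ _).1 h).2 ?_
          rw [hsum]
          exact hint
      obtain ⟨y, hy⟩ := ih _ hlt (x + t Z₀ • v) rfl
      exact ⟨y, fun Z hZ => (hround Z hZ).trans (hy Z hZ)⟩
    · push Not at hx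
      choose y hy using fun s => mem_intSubgroup.1 (hx s)
      refine ⟨y, fun Z _ => ?_⟩
      have : toReal y = x := funext hy
      rw [this]
      exact Rounds.refl _

/-! ### Pulling decompositions of compressed polytopes -/

/-- Adding a point with a different value of an affine function that is constant on an affinely
independent family. -/
theorem affineIndependent_cons {V : Type*} [AddCommGroup V] [Module ℝ V] {t : ℕ} {z : Fin t → V}
    (hz : AffineIndependent ℝ z) (x : V) (φ : V →ₗ[ℝ] ℝ) (c : ℝ) (hc : ∀ i, φ (z i) = c)
    (hx : φ x ≠ c) : AffineIndependent ℝ (Fin.cons x z : Fin (t + 1) → V) := by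
  rw [affineIndependent_iff_of_fintype] at hz ⊢
  intro w hw hwx
  rw [Finset.weightedVSub_eq_linear_combination _ hw] at hwx
  rw [Fin.sum_univ_succ] at hw hwx
  simp only [Fin.cons_zero, Fin.cons_succ] at hwx
  -- Applying `φ - c` to the affine relation kills all terms except that of `x`.
  have h0 : w 0 = 0 := by
    have := congrArg φ hwx
    simp only [map_add, map_smul, map_sum, hc, smul_eq_mul, map_zero, ← Finset.sum_mul] at this
    have h1 : w 0 * (φ x - c) = 0 := by
      linear_combination this - c * hw
    exact (mul_eq_zero.1 h1).resolve_right (sub_ne_zero.2 hx)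
  rw [h0, zero_add] at hw
  rw [h0, zero_smul, zero_add] at hwx
  have hrest := hz (fun i => w i.succ) hw
    (by rw [Finset.weightedVSub_eq_linear_combination _ hw]; exact hwx)
  intro i
  refine Fin.cases h0 hrest i

/-- Carathéodory's theorem for compressed polytopes, with coefficients in a subgroup of `ℝ`.
The polytope `{v | c j ≤ φ j v}` is given by slacks that are `0` or `1` at the points of `X`, and
each of its nonempty faces contains a point of `X`. -/
theorem exists_pulling_decomposition {V J : Type*} [AddCommGroup V] [Module ℝ V] [Fintype J]
    (φ : J → V →ₗ[ℝ] ℝ) (c : J → ℤ) (X : Set V) (G : AddSubgroup ℝ)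
    (hbdd : ∀ v, (∀ j, 0 ≤ φ j v) → v = 0)
    (hX : ∀ (T : Set J) (v : V), (∀ j, (c j : ℝ) ≤ φ j v) → (∀ j ∈ T, φ j v = c j) →
      ∃ x ∈ X, (∀ j, φ j x = c j ∨ φ j x = c j + 1) ∧ ∀ j ∈ T, φ j x = c j)
    (T : Set J) (w : V) (k : ℝ) (hk : 0 < k) (hkG : k ∈ G) (hwG : ∀ j, φ j w ∈ G)
    (hw : ∀ j, k * c j ≤ φ j w) (hT : ∀ j ∈ T, φ j w = k * c j) :
    ∃ (t : ℕ) (z : Fin t → V) (μ : Fin t → ℝ), AffineIndependent ℝ z ∧ (∀ i, z i ∈ X) ∧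
      (∀ i j, (c j : ℝ) ≤ φ j (z i)) ∧ (∀ i, ∀ j ∈ T, φ j (z i) = c j) ∧
      (∀ i, 0 < μ i) ∧ (∀ i, μ i ∈ G) ∧ ∑ i, μ i = k ∧ w = ∑ i, μ i • z i := by
  classical
  -- The set `T` of constraints known to be tight grows at each step.
  induction hn : (Tᶜ : Set J).ncard using Nat.strong_induction_on
    generalizing T w k with
  | _ n ih =>
    subst hn
    obtain ⟨x, hxX, hx01, hxT⟩ := hX T (k⁻¹ • w)
      (fun j => by
        rw [map_smul, smul_eq_mul, le_inv_mul_iff₀ hk]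
        exact hw j)
      (fun j hj => by
        rw [map_smul, smul_eq_mul, hT j hj, inv_mul_cancel_left₀ hk.ne'])
    have hxc : ∀ j, (c j : ℝ) ≤ φ j x := fun j => by
      rcases hx01 j with h | h <;> rw [h]
      linarith
    -- If `k x` can be subtracted in full, the remainder satisfies all homogeneous constraints and
    -- vanishes by `hbdd`.
    by_cases hsingle : ∀ j, φ j x = c j + 1 → k ≤ φ j w - k * c j
    · have hwk : w = k • x := by
        rw [← sub_eq_zero]
        refine hbdd _ fun j => ?_
        rw [map_sub, map_smul, smul_eq_mul]
        rcases hx01 j with h | h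
        · rw [h]
          linarith [hw j]
        · have := hsingle j h
          rw [h]
          linarith
      refine ⟨1, fun _ => x, fun _ => k, affineIndependent_of_subsingleton ℝ _, fun _ => hxX,
        fun _ => hxc, fun _ => hxT, fun _ => hk, fun _ => hkG, by simp, by simpa using hwk⟩
    · push Not at hsingle
      obtain ⟨j₁, hj₁, hj₁k⟩ := hsingle
      -- Subtracting `l x` and lowering `k` to `k - l` costs `l` exactly at the constraints with
      -- slack 1 at `x`. The greatest admissible `l` is therefore the least slack of `w` among them,
      -- attained at `j`.
      obtain ⟨j, hj, hmin⟩ := Finset.exists_min_image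
        (Finset.univ.filter fun j => φ j x = c j + 1) (fun j => φ j w - k * c j)
        ⟨j₁, by simpa using hj₁⟩
      have hjx : φ j x = c j + 1 := by simpa using hj
      obtain ⟨l, hl⟩ : ∃ l, l = φ j w - k * c j := ⟨_, rfl⟩
      have hlk : l < k := by
        have := hmin j₁ (by simpa using hj₁)
        linarith
      have hl0 : 0 ≤ l := by
        rw [hl]
        linarith [hw j]
      have hmulG : ∀ r ∈ G, ∀ n : ℤ, r * n ∈ G := fun r hr n => by
        have := G.zsmul_mem hr n
        rwa [zsmul_eq_mul, mul_comm] at this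
      have hlG : l ∈ G := by
        rw [hl]
        exact sub_mem (hwG j) (hmulG k hkG (c j))
      have hjT : j ∉ T := fun h => by
        have := hxT j h
        linarith
      have hslack : ∀ i, (k - l) * c i ≤ φ i (w - l • x) := by
        intro i
        rw [map_sub, map_smul, smul_eq_mul]
        rcases hx01 i with h | h
        · rw [h]
          linarith [hw i]
        · have := hmin i (by simpa using h)
          rw [h]
          linarith
      have hcard : (insert j T)ᶜ.ncard < Tᶜ.ncard :=
        Set.ncard_lt_ncard (compl_lt_compl_iff_lt.2 (Set.ssubset_insert hjT)) (Set.toFinite _)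
      obtain ⟨t, z, μ, hind, hzX, hzc, hzT, hμ, hμG, hsum, hcomb⟩ := ih _
        hcard
        (insert j T) (w - l • x) (k - l) (sub_pos.2 hlk) (sub_mem hkG hlG)
        (fun i => by
          rw [map_sub, map_smul, smul_eq_mul]
          refine sub_mem (hwG i) ?_
          rcases hx01 i with h | h
          · rw [h]
            exact hmulG l hlG _
          · rw [h, ← Int.cast_one, ← Int.cast_add]
            exact hmulG l hlG _)
        hslack
        (by
          rintro i (rfl | hi) <;> rw [map_sub, map_smul, smul_eq_mul]
          · rw [hjx, hl]
            ring
          · rw [hT i hi, hxT i hi]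
            ring)
        rfl
      rcases hl0.eq_or_lt with h0 | h0
      -- The constraint `j` was already tight at `w`, so `x` is not used.
      · subst h0
        rw [sub_zero] at hsum
        rw [zero_smul, sub_zero] at hcomb
        exact ⟨t, z, μ, hind, hzX, hzc, fun i a ha => hzT i a (Set.mem_insert_of_mem _ ha), hμ, hμG,
          hsum, hcomb⟩
      · refine ⟨t + 1, Fin.cons x z, Fin.cons l μ,
          affineIndependent_cons hind x (φ j) (c j) (fun i => hzT i j (Set.mem_insert _ _))
            (by rw [hjx]; linarith), ?_, ?_, ?_, ?_, ?_, ?_, ?_⟩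
        · exact Fin.cases hxX hzX
        · exact Fin.cases hxc hzc
        · exact Fin.cases hxT fun i a ha => hzT i a (Set.mem_insert_of_mem _ ha)
        · exact Fin.cases h0 hμ
        · exact Fin.cases hlG hμG
        · rw [Fin.sum_univ_succ]
          simp only [Fin.cons_zero, Fin.cons_succ, hsum]
          ring
        · rw [Fin.sum_univ_succ]
          simp only [Fin.cons_zero, Fin.cons_succ, ← hcomb]
          abel

/-- Carathéodory's theorem for the polytope of all roundings of `k⁻¹ w` with respect to two
laminar families. -/
theorem exists_rounding_decomposition {S : Type*} [Fintype S] {L₁ L₂ : Set (Finset S)}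
    (h₁ : NestedOrDisjoint L₁) (h₂ : NestedOrDisjoint L₂) (hs : ∀ s, {s} ∈ L₁ ∪ L₂)
    (G : AddSubgroup ℝ) (w : S → ℝ) (hw : ∀ s, w s ∈ G) (k : ℝ) (hk : 0 < k) (hkG : k ∈ G) :
    ∃ (t : ℕ) (z : Fin t → S → ℤ) (μ : Fin t → ℝ), AffineIndependent ℝ (fun i => toReal (z i)) ∧
      (∀ i, ∀ Z ∈ L₁ ∪ L₂, Rounds (∑ s ∈ Z, (k⁻¹ • w) s) (∑ s ∈ Z, toReal (z i) s)) ∧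
      (∀ i, 0 < μ i) ∧ (∀ i, μ i ∈ G) ∧ ∑ i, μ i = k ∧ w = ∑ i, μ i • toReal (z i) := by
  classical
  let a : Finset S → ℝ := fun Z => ∑ s ∈ Z, (k⁻¹ • w) s
  have hka : ∀ Z, k * a Z = ∑ s ∈ Z, w s := fun Z => by
    simp only [a, Pi.smul_apply, smul_eq_mul, ← Finset.mul_sum]
    rw [mul_inv_cancel_left₀ hk.ne']
  let σ : Finset S → (S → ℝ) →ₗ[ℝ] ℝ := fun Z => ∑ s ∈ Z, LinearMap.proj s
  have hσ : ∀ Z v, σ Z v = ∑ s ∈ Z, v s := fun Z v => by simp [σ]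
  -- Each member gives two constraints: `true` for its lower bound, `false` for its upper bound with
  -- the sign reversed.
  let φ : ↥(L₁ ∪ L₂) × Bool → (S → ℝ) →ₗ[ℝ] ℝ := fun j => bif j.2 then σ j.1 else -σ j.1
  let c : ↥(L₁ ∪ L₂) × Bool → ℤ := fun j => bif j.2 then ⌊a j.1⌋ else -⌈a j.1⌉
  have hcone : ∀ v, (∀ j, (c j : ℝ) ≤ φ j v) ↔ ∀ Z ∈ L₁ ∪ L₂, Rounds (a Z) (∑ s ∈ Z, v s) := by
    intro v
    simp [φ, c, Rounds, hσ, and_comm]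
  obtain ⟨t, z, μ, hind, hzX, hzc, -, hμ, hμG, hsum, hcomb⟩ :=
    exists_pulling_decomposition φ c (Set.range toReal) G
    (fun v hv => by
      funext s
      have h1 := hv (⟨{s}, hs s⟩, true)
      have h2 := hv (⟨{s}, hs s⟩, false)
      simp only [φ, cond_true, cond_false, LinearMap.neg_apply, hσ, Finset.sum_singleton] at h1 h2
      exact le_antisymm (neg_nonneg.1 h2) h1)
    (fun T v hv hvT => by
      obtain ⟨y, hy⟩ := exists_laminar_rounding h₁ h₂ hs v
      refine ⟨toReal y, ⟨y, rfl⟩, ?_, ?_⟩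
      · have hay : ∀ Z ∈ L₁ ∪ L₂, Rounds (a Z) (∑ s ∈ Z, toReal y s) :=
          fun Z hZ => ((hcone v).1 hv Z hZ).trans (hy Z hZ)
        have hval : ∀ Z, ∑ s ∈ Z, toReal y s = ((∑ s ∈ Z, y s : ℤ) : ℝ) := by simp [toReal]
        rintro ⟨⟨Z, hZ⟩, b⟩
        have := hay Z hZ
        simp only [Rounds, hval, Int.cast_le] at this
        -- Floor and ceiling differ by at most one, so an integer between them has slack 0 or 1 on
        -- either side.
        have hcf := Int.ceil_le_floor_add_one (a Z)
        cases b
        · simp only [φ, c, cond_false, LinearMap.neg_apply, hσ, hval]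
          norm_cast
          omega
        · simp only [φ, c, cond_true, hσ, hval]
          norm_cast
          omega
      -- A tight constraint means that the sum of `v` is an integer, which rounding does not change;
      -- hence `y` stays in the face.
      · rintro ⟨⟨Z, hZ⟩, b⟩ hj
        have h := hvT _ hj
        have hmem : ∑ s ∈ Z, v s ∈ intSubgroup := by
          cases b
          · simp only [φ, c, cond_false, LinearMap.neg_apply, hσ, Int.cast_neg, neg_inj] at h
            exact h ▸ intCast_mem_intSubgroup _
          · simp only [φ, c, cond_true, hσ] at h
            exact h ▸ intCast_mem_intSubgroup _
        rw [← h]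
        cases b <;> simp only [φ, cond_false, cond_true, LinearMap.neg_apply, hσ] <;>
          rw [(hy Z hZ).eq_of_mem hmem])
    ∅ w k hk hkG
    (by
      rintro ⟨⟨Z, hZ⟩, b⟩
      have : ∑ s ∈ Z, w s ∈ G := sum_mem fun s _ => hw s
      cases b
      · simpa [φ, hσ] using this
      · simpa [φ, hσ] using this)
    (by
      rintro ⟨⟨Z, hZ⟩, b⟩
      cases b
      · simp only [φ, c, cond_false, LinearMap.neg_apply, hσ, Int.cast_neg, ← hka]
        nlinarith [Int.le_ceil (a Z)]
      · simp only [φ, c, cond_true, hσ, ← hka]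
        exact mul_le_mul_of_nonneg_left (Int.floor_le _) hk.le)
    (fun j hj => hj.elim)
  choose y hy using hzX
  obtain rfl : (fun i => toReal (y i)) = z := funext hy
  exact ⟨t, y, μ, hind, fun i => (hcone _).1 (hzc i), hμ, hμG, hsum, hcomb⟩

/-! ### Decomposition properties of sets closed under rounding -/

/-- With a vector, the set contains all vectors whose sums over members of `L` are roundings. -/
def RoundingClosed {S : Type*} (L : Set (Finset S)) (Q : Set (S → ℝ)) : Prop :=
  ∀ x ∈ Q, ∀ y : S → ℝ, (∀ Z ∈ L, Rounds (∑ s ∈ Z, x s) (∑ s ∈ Z, y s)) → y ∈ Q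

theorem RoundingClosed.mono {S : Type*} {L L' : Set (Finset S)} {Q : Set (S → ℝ)}
    (h : RoundingClosed L Q) (hL : L ⊆ L') : RoundingClosed L' Q :=
  fun x hx y hy => h x hx y fun Z hZ => hy Z (hL hZ)

theorem RoundingClosed.inter {S : Type*} {L : Set (Finset S)} {Q Q' : Set (S → ℝ)}
    (h : RoundingClosed L Q) (h' : RoundingClosed L Q') : RoundingClosed L (Q ∩ Q') :=
  fun x hx y hy => ⟨h x hx.1 y hy, h' x hx.2 y hy⟩

theorem IsPolyhedron.convex {S : Type*} [Fintype S] {Q : Set (S → ℝ)} (h : IsPolyhedron Q) :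
    Convex ℝ Q := by
  obtain ⟨r, A, b, rfl⟩ := h
  exact (convex_Iic b).is_linear_preimage (Matrix.mulVecLin A).isLinear

/-- Zero is an integer, so rounding never crosses it. -/
theorem signConsistent_of_rounds {S : Type*} {z w : S → ℤ} {k : ℝ} (hk : 0 < k)
    (h : ∀ s, Rounds (k⁻¹ * w s) (z s)) : SignConsistent z w := by
  intro s
  have hs := h s
  simp only [Rounds, Int.cast_le] at hs
  constructor
  · intro hw
    refine le_trans (Int.floor_nonneg.2 ?_) hs.1
    have : (0 : ℝ) ≤ w s := by exact_mod_cast hw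
    positivity
  · intro hw
    refine hs.2.trans (Int.ceil_le.2 ?_)
    have : (w s : ℝ) ≤ 0 := by exact_mod_cast hw
    rw [Int.cast_zero]
    exact mul_nonpos_of_nonneg_of_nonpos (inv_pos.2 hk).le this

section Properties

variable {S : Type*} [Fintype S] {L₁ L₂ : Set (Finset S)} {Q : Set (S → ℝ)}

/-- The decomposition with `k = 1` and all of `ℝ` as coefficient group writes each point as a convex
combination of its own integral roundings. -/
theorem isIntegralPolyhedron_of_roundingClosed
    (h₁ : NestedOrDisjoint L₁) (h₂ : NestedOrDisjoint L₂) (hs : ∀ s, {s} ∈ L₁ ∪ L₂)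
    (hQ : IsPolyhedron Q) (hcl : RoundingClosed (L₁ ∪ L₂) Q) : IsIntegralPolyhedron Q := by
  refine ⟨hQ, Set.Subset.antisymm (fun x hx => ?_) (convexHull_min (fun x hx => hx.1) hQ.convex)⟩
  obtain ⟨t, z, μ, -, hz, hμ, -, hsum, rfl⟩ :=
    exists_rounding_decomposition h₁ h₂ hs ⊤ x (fun _ => trivial) 1 one_pos trivial
  refine (convex_convexHull ℝ _).sum_mem (fun i _ => (hμ i).le) hsum fun i _ =>
    subset_convexHull ℝ _ ⟨hcl _ hx _ fun Z hZ => ?_, z i, rfl⟩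
  simpa using hz i Z hZ

/-- The same decomposition with integral coefficients. The singletons provide sign-consistency. -/
theorem signConsistentIntegerCaratheodory_of_roundingClosed
    (h₁ : NestedOrDisjoint L₁) (h₂ : NestedOrDisjoint L₂) (hs : ∀ s, {s} ∈ L₁ ∪ L₂)
    (hcl : RoundingClosed (L₁ ∪ L₂) Q) : SignConsistentIntegerCaratheodory Q := by
  rintro k hk w ⟨y, hy, hwy⟩
  have hk' : (0 : ℝ) < k := by exact_mod_cast hk
  obtain ⟨t, z, μ, hind, hz, hμ, hμG, hsum, hcomb⟩ := exists_rounding_decomposition h₁ h₂ hs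
    intSubgroup (toReal w) (fun s => intCast_mem_intSubgroup (w s)) k hk'
    (mem_intSubgroup.2 ⟨k, by simp⟩)
  have hyw : (k : ℝ)⁻¹ • toReal w = y := by
    rw [hwy, smul_smul, inv_mul_cancel₀ hk'.ne', one_smul]
  choose ν hν using fun i => mem_intSubgroup.1 (hμG i)
  have hν0 : ∀ i, 0 < ν i := fun i => by
    have := hμ i
    rw [← hν i] at this
    exact_mod_cast this
  obtain ⟨κ, hκ⟩ : ∃ κ : Fin t → ℕ, ∀ i, (κ i : ℤ) = ν i :=
    ⟨fun i => (ν i).toNat, fun i => Int.toNat_of_nonneg (hν0 i).le⟩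
  have hκμ : ∀ i, (κ i : ℝ) = μ i := fun i => by
    rw [← hν i, ← hκ i, Int.cast_natCast]
  refine ⟨t, z, κ, hind, fun i => hcl y hy _ (hyw ▸ hz i),
    fun i => signConsistent_of_rounds hk' fun s => ?_, fun i => ?_, ?_, ?_⟩
  · simpa [toReal] using hz i {s} (hs s)
  · have := hν0 i
    rw [← hκ i] at this
    exact_mod_cast this
  · have : ((∑ i, κ i : ℕ) : ℝ) = k := by
      rw [← hsum]
      push_cast
      exact Finset.sum_congr rfl fun i _ => hκμ i
    exact_mod_cast this
  · funext s
    have := congrFun hcomb s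
    simp only [toReal, Finset.sum_apply, Pi.smul_apply, smul_eq_mul, ← hκμ] at this
    simp only [Finset.sum_apply, nsmul_eq_mul]
    exact_mod_cast this

theorem SignConsistentIntegerCaratheodory.decomposition
    (h : SignConsistentIntegerCaratheodory Q) (hQ : IsIntegralPolyhedron Q) :
    SignConsistentIntegerDecomposition Q := by
  refine ⟨hQ, fun k hk w hw => ?_⟩
  obtain ⟨t, z, μ, -, hz, hsign, -, rfl, rfl⟩ := h k hk w hw
  -- Each `z i` is repeated `μ i` times.
  refine ⟨fun i => z (finSigmaFinEquiv.symm i).1, fun i => hz _, fun i => hsign _, ?_⟩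
  rw [Equiv.sum_comp finSigmaFinEquiv.symm (fun p => z p.1), Fintype.sum_sigma]
  simp

end Properties

/-! ### Infinite bounds under rounding and division -/

theorem lowerLE_coe (a : ℤ) (r : ℝ) : LowerLE a r ↔ (a : ℝ) ≤ r := by
  rw [LowerLE, WithBot.map_coe, WithBot.coe_le_coe]

theorem lEUpper_coe (r : ℝ) (a : ℤ) : LEUpper r a ↔ r ≤ (a : ℝ) := by
  rw [LEUpper, WithTop.map_coe, WithTop.coe_le_coe]

theorem lowerLE_bot (r : ℝ) : LowerLE ⊥ r := bot_le

theorem lEUpper_top (r : ℝ) : LEUpper r ⊤ := le_top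

theorem LowerLE.of_rounds {l : WithBot ℤ} {a b : ℝ} (h : LowerLE l a) (hab : Rounds a b) :
    LowerLE l b := by
  induction l using WithBot.recBotCoe with
  | bot => exact lowerLE_bot b
  | coe l =>
    rw [lowerLE_coe] at h ⊢
    exact (Int.cast_le.2 (Int.le_floor.2 h)).trans hab.1

theorem LEUpper.of_rounds {u : WithTop ℤ} {a b : ℝ} (h : LEUpper a u) (hab : Rounds a b) :
    LEUpper b u := by
  induction u using WithTop.recTopCoe with
  | top => exact lEUpper_top b
  | coe u =>
    rw [lEUpper_coe] at h ⊢
    exact hab.2.trans (Int.cast_le.2 (Int.ceil_le.2 h))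

theorem lowerLE_intCast {l : WithBot ℤ} {n : ℤ} : LowerLE l (n : ℝ) ↔ l ≤ (n : WithBot ℤ) := by
  induction l using WithBot.recBotCoe with
  | bot => exact iff_of_true (lowerLE_bot _) bot_le
  | coe l => rw [lowerLE_coe, WithBot.coe_le_coe, Int.cast_le]

theorem lEUpper_intCast {u : WithTop ℤ} {n : ℤ} : LEUpper (n : ℝ) u ↔ (n : WithTop ℤ) ≤ u := by
  induction u using WithTop.recTopCoe with
  | top => exact iff_of_true (lEUpper_top _) le_top
  | coe u => rw [lEUpper_coe, WithTop.coe_le_coe, Int.cast_le]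

theorem LowerLE.floorDiv {l : WithBot ℤ} {r : ℝ} (h : LowerLE l r) (k : ℕ) :
    LowerLE (floorDiv k l) ((k : ℝ)⁻¹ * r) := by
  induction l using WithBot.recBotCoe with
  | bot => exact lowerLE_bot _
  | coe l =>
    rw [lowerLE_coe] at h
    rw [_root_.floorDiv, WithBot.map_coe, lowerLE_coe]
    have h1 : ((⌊(l : ℚ) / (k : ℚ)⌋ : ℤ) : ℝ) ≤ (l : ℝ) / k := by
      exact_mod_cast (Rat.cast_le (K := ℝ)).2 (Int.floor_le ((l : ℚ) / (k : ℚ)))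
    refine h1.trans ?_
    rw [inv_mul_eq_div]
    gcongr

theorem LEUpper.ceilDiv {u : WithTop ℤ} {r : ℝ} (h : LEUpper r u) (k : ℕ) :
    LEUpper ((k : ℝ)⁻¹ * r) (ceilDiv k u) := by
  induction u using WithTop.recTopCoe with
  | top => exact lEUpper_top _
  | coe u =>
    rw [lEUpper_coe] at h
    rw [_root_.ceilDiv, WithTop.map_coe, lEUpper_coe]
    have h1 : (u : ℝ) / k ≤ ((⌈(u : ℚ) / (k : ℚ)⌉ : ℤ) : ℝ) := by
      exact_mod_cast (Rat.cast_le (K := ℝ)).2 (Int.le_ceil ((u : ℚ) / (k : ℚ)))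
    refine le_trans ?_ h1
    rw [inv_mul_eq_div]
    gcongr

/-! ### Polyhedra given by bounds on sums -/

section Polyhedra

variable {S : Type*} [Fintype S]

theorem isPolyhedron_iInter {ι : Type*} [Finite ι] {Q : ι → Set (S → ℝ)}
    (h : ∀ i, IsPolyhedron (Q i)) : IsPolyhedron (⋂ i, Q i) := by
  have := Fintype.ofFinite ι
  choose r A b hQ using h
  let e := (Fintype.equivFin (Σ i, Fin (r i))).symm
  refine ⟨_, fun j => A (e j).1 (e j).2, fun j => b (e j).1 (e j).2, ?_⟩
  ext x
  simp only [Set.mem_iInter, hQ, Set.mem_ofPred_eq]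
  constructor
  · exact fun hx j => hx (e j).1 (e j).2
  · intro hx i j
    have : ∀ p : Σ i, Fin (r i), (A p.1 *ᵥ x) p.2 ≤ b p.1 p.2 := fun p => by
      obtain ⟨j, rfl⟩ := e.surjective p
      exact hx j
    exact this ⟨i, j⟩

theorem IsPolyhedron.inter {Q Q' : Set (S → ℝ)} (h : IsPolyhedron Q) (h' : IsPolyhedron Q') :
    IsPolyhedron (Q ∩ Q') := by
  rw [Set.inter_eq_iInter]
  exact isPolyhedron_iInter fun b => by cases b <;> assumption

theorem isPolyhedron_univ : IsPolyhedron (Set.univ : Set (S → ℝ)) :=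
  ⟨0, 0, 0, by ext; simp⟩

theorem isPolyhedron_halfspace (a : S → ℝ) (b : ℝ) : IsPolyhedron {x | a ⬝ᵥ x ≤ b} :=
  ⟨1, fun _ => a, fun _ => b, by ext; simp [Pi.le_def, Matrix.mulVec]⟩

theorem isPolyhedron_lowerLE (Z : Finset S) (l : WithBot ℤ) :
    IsPolyhedron {x : S → ℝ | LowerLE l (∑ s ∈ Z, x s)} := by
  classical
  induction l using WithBot.recBotCoe with
  | bot =>
    simp only [lowerLE_bot]
    exact isPolyhedron_univ
  | coe l =>
    convert isPolyhedron_halfspace (fun s => if s ∈ Z then -1 else 0 : S → ℝ) (-l) using 3 with x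
    rw [lowerLE_coe]
    simp [dotProduct, Finset.sum_ite_mem]

theorem isPolyhedron_lEUpper (Z : Finset S) (u : WithTop ℤ) :
    IsPolyhedron {x : S → ℝ | LEUpper (∑ s ∈ Z, x s) u} := by
  classical
  induction u using WithTop.recTopCoe with
  | top =>
    simp only [lEUpper_top]
    exact isPolyhedron_univ
  | coe u =>
    convert isPolyhedron_halfspace (fun s => if s ∈ Z then 1 else 0 : S → ℝ) u using 3 with x
    rw [lEUpper_coe]
    simp [dotProduct, Finset.sum_ite_mem]

end Polyhedra

/-- The vectors whose sums over the sets of an indexed family obey the given bounds. -/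
def sumBounds {S ι : Type*} (Z : ι → Finset S) (p : ι → WithBot ℤ) (b : ι → WithTop ℤ) :
    Set (S → ℝ) :=
  {x | ∀ i, LowerLE (p i) (∑ s ∈ Z i, x s) ∧ LEUpper (∑ s ∈ Z i, x s) (b i)}

theorem isPolyhedron_sumBounds {S ι : Type*} [Fintype S] [Finite ι] (Z : ι → Finset S)
    (p : ι → WithBot ℤ) (b : ι → WithTop ℤ) : IsPolyhedron (sumBounds Z p b) := by
  rw [sumBounds, Set.ofPred_forall]
  exact isPolyhedron_iInter fun i => (isPolyhedron_lowerLE (Z i) (p i)).inter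
    (isPolyhedron_lEUpper (Z i) (b i))

theorem roundingClosed_sumBounds {S ι : Type*} (Z : ι → Finset S)
    (p : ι → WithBot ℤ) (b : ι → WithTop ℤ) : RoundingClosed (Set.range Z) (sumBounds Z p b) :=
  fun _ hx _ hy i => ⟨(hx i).1.of_rounds (hy _ ⟨i, rfl⟩), (hx i).2.of_rounds (hy _ ⟨i, rfl⟩)⟩

theorem box_eq_sumBounds {S : Type*} (f : S → WithBot ℤ) (g : S → WithTop ℤ) :
    box f g = sumBounds (fun s => {s}) f g := by
  simp [box, sumBounds]

theorem plank_eq_sumBounds {S : Type*} [Fintype S] (α : WithBot ℤ) (β : WithTop ℤ) :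
    plank S α β = sumBounds (fun _ : Unit => Finset.univ) (fun _ => α) (fun _ => β) := by
  simp [plank, sumBounds]

/-- This brings the constraints of the box and the plank into one of the two families. -/
theorem NestedOrDisjoint.union_singletons_univ {S : Type*} [Fintype S] {L : Set (Finset S)}
    (h : NestedOrDisjoint L) :
    NestedOrDisjoint (L ∪ Set.range (fun s => {s}) ∪ Set.range fun _ : Unit => Finset.univ) := by
  rintro X ((hX | ⟨s, rfl⟩) | ⟨-, rfl⟩) Y ((hY | ⟨s', rfl⟩) | ⟨-, rfl⟩)
  · exact h X hX Y hY
  · by_cases hs : s' ∈ X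
    · exact Or.inr (Or.inl (by simpa using hs))
    · exact Or.inr (Or.inr (by simpa using hs))
  · exact Or.inl (Finset.subset_univ _)
  · by_cases hs : s ∈ Y
    · exact Or.inl (by simpa using hs)
    · exact Or.inr (Or.inr (by simpa using hs))
  · by_cases hs : s = s'
    · exact Or.inl (by simp [hs])
    · exact Or.inr (Or.inr (by simpa using hs))
  · exact Or.inl (Finset.subset_univ _)
  all_goals exact Or.inr (Or.inl (Finset.subset_univ _))

theorem sumBounds_inter_box_inter_plank {S ι₁ ι₂ : Type*} [Fintype S] [Finite ι₁] [Finite ι₂]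
    {Z₁ : ι₁ → Finset S} {Z₂ : ι₂ → Finset S}
    (h₁ : NestedOrDisjoint (Set.range Z₁)) (h₂ : NestedOrDisjoint (Set.range Z₂))
    (p₁ : ι₁ → WithBot ℤ) (b₁ : ι₁ → WithTop ℤ) (p₂ : ι₂ → WithBot ℤ) (b₂ : ι₂ → WithTop ℤ)
    (f : S → WithBot ℤ) (g : S → WithTop ℤ) (α : WithBot ℤ) (β : WithTop ℤ) :
    SignConsistentIntegerCaratheodory
      (sumBounds Z₁ p₁ b₁ ∩ sumBounds Z₂ p₂ b₂ ∩ box f g ∩ plank S α β) ∧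
    SignConsistentIntegerDecomposition
      (sumBounds Z₁ p₁ b₁ ∩ sumBounds Z₂ p₂ b₂ ∩ box f g ∩ plank S α β) := by
  have h₁' := h₁.union_singletons_univ
  set L := Set.range Z₁ ∪ Set.range (fun s => {s}) ∪ Set.range fun _ : Unit => Finset.univ with hL
  have hs : ∀ s, {s} ∈ L ∪ Set.range Z₂ := fun s => Or.inl (Or.inl (Or.inr ⟨s, rfl⟩))
  rw [box_eq_sumBounds, plank_eq_sumBounds]
  have hcl : RoundingClosed (L ∪ Set.range Z₂) (sumBounds Z₁ p₁ b₁ ∩ sumBounds Z₂ p₂ b₂ ∩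
      sumBounds (fun s => {s}) f g ∩
        sumBounds (fun _ : Unit => Finset.univ) (fun _ => α) (fun _ => β)) :=
    ((((roundingClosed_sumBounds Z₁ p₁ b₁).mono fun Z hZ => Or.inl (Or.inl (Or.inl hZ))).inter
      ((roundingClosed_sumBounds Z₂ p₂ b₂).mono fun Z hZ => Or.inr hZ)).inter
      ((roundingClosed_sumBounds _ f g).mono fun Z hZ => Or.inl (Or.inl (Or.inr hZ)))).inter
      ((roundingClosed_sumBounds _ _ _).mono fun Z hZ => Or.inl (Or.inr hZ))
  have hC := signConsistentIntegerCaratheodory_of_roundingClosed h₁' h₂ hs hcl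
  exact ⟨hC, hC.decomposition (isIntegralPolyhedron_of_roundingClosed h₁' h₂ hs
    ((((isPolyhedron_sumBounds _ _ _).inter (isPolyhedron_sumBounds _ _ _)).inter
      (isPolyhedron_sumBounds _ _ _)).inter (isPolyhedron_sumBounds _ _ _)) hcl)⟩

/-- Outside the family only the empty set has finite bounds, and these read `0 ≤ 0 ≤ 0`. -/
theorem IsLaminarGPolymatroid.exists_eq_sumBounds {S : Type*} [DecidableEq S] {Q : Set (S → ℝ)}
    (h : IsLaminarGPolymatroid Q) :
    ∃ (L : Set (Finset S)) (p : L → WithBot ℤ) (b : L → WithTop ℤ),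
      NestedOrDisjoint (Set.range (Subtype.val : L → Finset S)) ∧
      Q = sumBounds (Subtype.val : L → Finset S) p b := by
  obtain ⟨L, p, b, hL, -, hp, hb, hout, rfl⟩ := h
  refine ⟨L, fun Z => p Z, fun Z => b Z, by simpa using hL.nestedOrDisjoint, ?_⟩
  ext x
  refine ⟨fun hx Z => hx Z, fun hx Z => ?_⟩
  by_cases hZ : Z ∈ L
  · exact hx ⟨Z, hZ⟩
  · rcases Z.eq_empty_or_nonempty with rfl | hne
    · rw [hp, hb, Finset.sum_empty]
      exact ⟨(lowerLE_coe 0 0).2 (by simp), (lEUpper_coe 0 0).2 (by simp)⟩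
    · obtain ⟨h1, h2⟩ := hout Z hne hZ
      rw [h1, h2]
      exact ⟨lowerLE_bot _, lEUpper_top _⟩

/-- Prefixes of disjoint chains are nested or disjoint. -/
theorem nestedOrDisjoint_prefixes {S ι β γ : Type*} [LinearOrder γ] {Z : ι → Finset S}
    (blk : S → β) (pos : S → γ) (b : ι → β) (c : ι → γ)
    (hZ : ∀ i s, s ∈ Z i ↔ blk s = b i ∧ pos s ≤ c i) : NestedOrDisjoint (Set.range Z) := by
  rintro _ ⟨i, rfl⟩ _ ⟨j, rfl⟩
  by_cases hb : b i = b j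
  · rcases le_total (c i) (c j) with h | h
    · refine Or.inl fun s hs => ?_
      rw [hZ] at hs ⊢
      exact ⟨hs.1.trans hb, hs.2.trans h⟩
    · refine Or.inr (Or.inl fun s hs => ?_)
      rw [hZ] at hs ⊢
      exact ⟨hs.1.trans hb.symm, hs.2.trans h⟩
  · refine Or.inr (Or.inr (Finset.disjoint_left.2 fun s hs hs' => hb ?_))
    rw [hZ] at hs hs'
    exact hs.1.symm.trans hs'.1

theorem IsPrefixBoundedGPolymatroid.exists_eq_sumBounds {S : Type*} {Q : Set (S → ℝ)}
    (h : IsPrefixBoundedGPolymatroid Q) :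
    ∃ (q : ℕ) (t : Fin q → ℕ) (Z : (Σ i : Fin q, Fin (t i)) → Finset S)
      (p : (Σ i : Fin q, Fin (t i)) → WithBot ℤ) (b : (Σ i : Fin q, Fin (t i)) → WithTop ℤ),
      NestedOrDisjoint (Set.range Z) ∧ Q = sumBounds Z p b := by
  obtain ⟨q, t, e, φ, γ, -, rfl⟩ := h
  refine ⟨q, t, fun a => (Finset.Iic a.2).map
    ((Function.Embedding.sigmaMk a.1).trans e.toEmbedding), fun a => φ a.1 a.2,
    fun a => γ a.1 a.2, ?_, ?_⟩
  -- Positions are compared in `ℕ`, since their type depends on the block.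
  · refine nestedOrDisjoint_prefixes (fun s => (e.symm s).1) (fun s => ((e.symm s).2 : ℕ))
      Sigma.fst (fun a => (a.2 : ℕ)) ?_
    rintro ⟨i, k⟩ s
    obtain ⟨⟨i', l⟩, rfl⟩ := e.surjective s
    rw [Equiv.symm_apply_apply]
    simp only [Finset.mem_map, Finset.mem_Iic, Function.Embedding.trans_apply,
      Equiv.coe_toEmbedding, Function.Embedding.sigmaMk_apply, EmbeddingLike.apply_eq_iff_eq]
    constructor
    · rintro ⟨l', hl', h⟩
      cases h
      exact ⟨rfl, hl'⟩
    · rintro ⟨rfl, hl⟩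
      exact ⟨l, hl, rfl⟩
  · ext x
    simp [sumBounds, elementaryPrefixBounded, Sigma.forall]

/-! ### Prefix-bounded matrices -/

section PrefixBoundedMatrices

variable {m n : ℕ}

/-- The positions of a horizontal prefix. -/
def rowPrefix (s : Fin m × Fin n) : Finset (Fin m × Fin n) :=
  (Finset.Iic s.2).map ⟨fun l => (s.1, l), fun _ _ h => congrArg Prod.snd h⟩

/-- The positions of a vertical prefix. -/
def columnPrefix (s : Fin m × Fin n) : Finset (Fin m × Fin n) :=
  (Finset.Iic s.1).map ⟨fun h => (h, s.2), fun _ _ h => congrArg Prod.fst h⟩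

theorem nestedOrDisjoint_rowPrefix :
    NestedOrDisjoint (Set.range (rowPrefix : Fin m × Fin n → _)) := by
  refine nestedOrDisjoint_prefixes Prod.fst Prod.snd Prod.fst Prod.snd ?_
  rintro ⟨i, j⟩ ⟨i', j'⟩
  rw [rowPrefix, Finset.mem_map]
  constructor
  · rintro ⟨l, hl, h⟩
    cases h
    exact ⟨rfl, Finset.mem_Iic.1 hl⟩
  · rintro ⟨rfl, hj⟩
    exact ⟨j', Finset.mem_Iic.2 hj, rfl⟩

theorem nestedOrDisjoint_columnPrefix :
    NestedOrDisjoint (Set.range (columnPrefix : Fin m × Fin n → _)) := by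
  refine nestedOrDisjoint_prefixes Prod.snd Prod.fst Prod.snd Prod.fst ?_
  rintro ⟨i, j⟩ ⟨i', j'⟩
  rw [columnPrefix, Finset.mem_map]
  constructor
  · rintro ⟨h, hh, heq⟩
    cases heq
    exact ⟨rfl, Finset.mem_Iic.1 hh⟩
  · rintro ⟨rfl, hi⟩
    exact ⟨i', Finset.mem_Iic.2 hi, rfl⟩

/-- The real matrices obeying the bounds. -/
def pbmPolyhedron (B : PBMBounds m n) : Set (Fin m × Fin n → ℝ) :=
  sumBounds rowPrefix B.Φ₁ B.Γ₁ ∩ sumBounds columnPrefix B.Φ₂ B.Γ₂ ∩ box B.f B.g ∩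
    plank (Fin m × Fin n) B.α B.β

theorem pbmPolyhedron_properties (B : PBMBounds m n) :
    SignConsistentIntegerCaratheodory (pbmPolyhedron B) ∧
    SignConsistentIntegerDecomposition (pbmPolyhedron B) :=
  sumBounds_inter_box_inter_plank nestedOrDisjoint_rowPrefix nestedOrDisjoint_columnPrefix
    _ _ _ _ _ _ _ _

theorem toReal_mem_pbmPolyhedron {B : PBMBounds m n} {A : Fin m × Fin n → ℤ} :
    toReal A ∈ pbmPolyhedron B ↔ IsPBM B A := by
  have hrow : ∀ s : Fin m × Fin n, ∑ a ∈ rowPrefix s, toReal A a =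
      ((∑ l ∈ Finset.Iic s.2, A (s.1, l) : ℤ) : ℝ) := fun s => by
    rw [rowPrefix, Finset.sum_map, Int.cast_sum]
    rfl
  have hcol : ∀ s : Fin m × Fin n, ∑ a ∈ columnPrefix s, toReal A a =
      ((∑ h ∈ Finset.Iic s.1, A (h, s.2) : ℤ) : ℝ) := fun s => by
    rw [columnPrefix, Finset.sum_map, Int.cast_sum]
    rfl
  have htot : ∑ s, toReal A s = ((∑ s, A s : ℤ) : ℝ) := by simp [toReal]
  have hent : ∀ s, toReal A s = ((A s : ℤ) : ℝ) := fun _ => rfl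
  simp only [pbmPolyhedron, sumBounds, box, plank, Set.mem_inter_iff, Set.mem_ofPred_eq, hrow, hcol,
    htot, lowerLE_intCast, lEUpper_intCast]
  simp only [hent, lowerLE_intCast, lEUpper_intCast]
  constructor
  · rintro ⟨⟨⟨h1, h2⟩, h3⟩, h4⟩
    exact ⟨fun i j => h1 (i, j), fun i j => h2 (i, j), h3, h4⟩
  · rintro ⟨h1, h2, h3, h4⟩
    exact ⟨⟨⟨fun s => h1 s.1 s.2, fun s => h2 s.1 s.2⟩, h3⟩, h4⟩

/-- The polyhedron is integral and its integral points are exactly the admissible matrices. -/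
theorem pbmHull_eq_pbmPolyhedron (B : PBMBounds m n) : pbmHull B = pbmPolyhedron B := by
  rw [(pbmPolyhedron_properties B).2.1.2, pbmHull]
  congr 1
  ext x
  constructor
  · rintro ⟨A, hA, rfl⟩
    exact ⟨toReal_mem_pbmPolyhedron.2 hA, A, rfl⟩
  · rintro ⟨hx, A, rfl⟩
    exact ⟨A, toReal_mem_pbmPolyhedron.1 hx, rfl⟩

theorem smul_mem_pbmPolyhedron_div {B : PBMBounds m n} {x : Fin m × Fin n → ℝ}
    (hx : x ∈ pbmPolyhedron B) (k : ℕ) : (k : ℝ)⁻¹ • x ∈ pbmPolyhedron (B.div k) := by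
  obtain ⟨⟨⟨h1, h2⟩, h3⟩, h4⟩ := hx
  refine ⟨⟨⟨fun s => ?_, fun s => ?_⟩, fun s => ?_⟩, ?_⟩
  · simp only [Pi.smul_apply, smul_eq_mul, ← Finset.mul_sum]
    exact ⟨(h1 s).1.floorDiv k, (h1 s).2.ceilDiv k⟩
  · simp only [Pi.smul_apply, smul_eq_mul, ← Finset.mul_sum]
    exact ⟨(h2 s).1.floorDiv k, (h2 s).2.ceilDiv k⟩
  · exact ⟨(h3 s).1.floorDiv k, (h3 s).2.ceilDiv k⟩
  · simp only [plank, Set.mem_ofPred_eq, Pi.smul_apply, smul_eq_mul, ← Finset.mul_sum]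
    exact ⟨h4.1.floorDiv k, h4.2.ceilDiv k⟩

theorem IsPBM.exists_decomposition {B : PBMBounds m n} {A : Fin m × Fin n → ℤ} (hA : IsPBM B A)
    {k : ℕ} (hk : 0 < k) :
    ∃ A' : Fin k → Fin m × Fin n → ℤ,
      (∀ i, IsPBM (B.div k) (A' i)) ∧ (∀ i, SignConsistent (A' i) A) ∧ A = ∑ i, A' i := by
  have hk' : (k : ℝ) ≠ 0 := by exact_mod_cast hk.ne'
  -- The divided bounds define another polyhedron of the same kind, and `A = k (k⁻¹ A)` lies in its
  -- `k`-elongation.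
  obtain ⟨A', h1, h2, h3⟩ := (pbmPolyhedron_properties (B.div k)).2.2 k hk A
    ⟨_, smul_mem_pbmPolyhedron_div (toReal_mem_pbmPolyhedron.2 hA) k, by
      rw [smul_smul, mul_inv_cancel₀ hk', one_smul]⟩
  exact ⟨A', fun i => toReal_mem_pbmPolyhedron.1 (h1 i), h2, h3⟩

end PrefixBoundedMatrices

theorem mainTheorem10 :
    -- two laminar g-polymatroids intersected with a box and a plank
    (∀ (S : Type*) [Fintype S] [DecidableEq S] (Q₁ Q₂ : Set (S → ℝ))
      (f : S → WithBot ℤ) (g : S → WithTop ℤ) (α : WithBot ℤ) (β : WithTop ℤ),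
      IsLaminarGPolymatroid Q₁ → IsLaminarGPolymatroid Q₂ →
      (∀ s, BoundLE (f s) (g s)) → BoundLE α β →
      SignConsistentIntegerCaratheodory (Q₁ ∩ Q₂ ∩ box f g ∩ plank S α β) ∧
      SignConsistentIntegerDecomposition (Q₁ ∩ Q₂ ∩ box f g ∩ plank S α β)) ∧
    -- two prefix-bounded g-polymatroids intersected with a box and a plank
    (∀ (S : Type*) [Fintype S] (Q₁ Q₂ : Set (S → ℝ))
      (f : S → WithBot ℤ) (g : S → WithTop ℤ) (α : WithBot ℤ) (β : WithTop ℤ),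
      IsPrefixBoundedGPolymatroid Q₁ → IsPrefixBoundedGPolymatroid Q₂ →
      (∀ s, BoundLE (f s) (g s)) → BoundLE α β →
      SignConsistentIntegerCaratheodory (Q₁ ∩ Q₂ ∩ box f g ∩ plank S α β) ∧
      SignConsistentIntegerDecomposition (Q₁ ∩ Q₂ ∩ box f g ∩ plank S α β)) ∧
    -- the convex hull of prefix-bounded matrices
    (∀ (m n : ℕ) (B : PBMBounds m n), B.Consistent →
      SignConsistentIntegerCaratheodory (pbmHull B) ∧
      SignConsistentIntegerDecomposition (pbmHull B)) ∧
    -- decomposition of a single prefix-bounded matrix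
    (∀ (m n : ℕ) (B : PBMBounds m n), B.Consistent →
      ∀ A : Fin m × Fin n → ℤ, IsPBM B A → ∀ k : ℕ, 0 < k →
      ∃ A' : Fin k → Fin m × Fin n → ℤ,
        (∀ i, IsPBM (B.div k) (A' i)) ∧
        (∀ i, SignConsistent (A' i) A) ∧
        A = ∑ i, A' i) := by
  refine ⟨fun S _ _ Q₁ Q₂ f g α β hQ₁ hQ₂ _ _ => ?_, fun S _ Q₁ Q₂ f g α β hQ₁ hQ₂ _ _ => ?_,
    fun m n B _ => ?_, fun m n B _ A hA k hk => hA.exists_decomposition hk⟩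
  · obtain ⟨L₁, p₁, b₁, h₁, rfl⟩ := hQ₁.exists_eq_sumBounds
    obtain ⟨L₂, p₂, b₂, h₂, rfl⟩ := hQ₂.exists_eq_sumBounds
    exact sumBounds_inter_box_inter_plank h₁ h₂ p₁ b₁ p₂ b₂ f g α β
  · obtain ⟨_, _, _, p₁, b₁, h₁, rfl⟩ := hQ₁.exists_eq_sumBounds
    obtain ⟨_, _, _, p₂, b₂, h₂, rfl⟩ := hQ₂.exists_eq_sumBounds
    exact sumBounds_inter_box_inter_plank h₁ h₂ p₁ b₁ p₂ b₂ f g α β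
  · rw [pbmHull_eq_pbmPolyhedron]
    exact pbmPolyhedron_properties B
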